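/- Let $k\ge 1$. A $k$-graph is a countable small category $\Lambda$ (with range and source maps $r,s$; $\mu\nu$ is defined when $s(\mu)=r(\nu)$) with a degree functor $d:\Lambda\to\mathbb N^k$ such that, whenever $d(\lambda)=m+n$, there are unique $\mu,\nu$ with $d(\mu)=m$, $d(\nu)=n$ and $\lambda=\mu\nu$; write $\lambda(0,m)=\mu$. Vertices $v\in\Lambda^0$ are identified with identity morphisms, and $v\Lambda=\{\lambda: r(\lambda)=v\}$. Let $\Lambda^{\min}(\lambda,\mu)$ be the set of pairs $(\rho,\tau)$ with $\lambda\rho=\mu\tau$ and $d(\lambda\rho)=d(\lambda)\vee d(\mu)$. $\Lambda$ is finitely aligned if all these sets are finite. A set $E\subseteq v\Lambda$ is exhaustive if for every $\lambda\in v\Lambda$ there is $\mu\in E$ with $\Lambda^{\min}(\lambda,\mu)\neq\emptyset$. A boundary path of $\Lambda$ is a degree-preserving functor $x:\Omega_{k,m}\to\Lambda$, where $m=d(x)\in(\mathbb N\cup\{\infty\})^k$ and $\Omega_{k,m}$ is the $k$-graph of pairs $(p,q)\in\mathbb N^k\times\mathbb N^k$ with $p\le q\le m$, $r(p,q)=p$,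 $s(p,q)=q$, $d(p,q)=q-p$, such that for all $n\in\mathbb N^k$ with $n\le m$ and all finite exhaustive $E\subseteq x(n,n)\Lambda$ there is $\lambda\in E$ with $n+d(\lambda)\le m$ and $x(n,n+d(\lambda))=\lambda$. Let $\partial\Lambda$ be the set of boundary paths, $\sigma^p(x)(a,b)=x(a+p,b+p)$ the shift (for $p\le d(x)$), and $Z(\lambda)=\{x\in\partial\Lambda: d(\lambda)\le d(x),\ x(0,d(\lambda))=\lambda\}$. The boundary path groupoid $\mathcal G_\Lambda$ is the set of triples $(x,m,y)\in\partial\Lambda\times\mathbb Z^k\times\partial\Lambda$ for which there are $p,q\in\mathbb N^k$ with $p\le d(x)$, $q\le d(y)$, $p-q=m$ and $\sigma^p(x)=\sigma^q(y)$, with $r(x,m,y)=x$, $s(x,m,y)=y$, $(x,m,y)(y,n,z)=(x,m+n,z)$ and $(x,m,y)^{-1}=(y,-m,x)$. Its topology is generated by the sets $Z(\lambda*_s\mu)\setminus\bigcup_{\nu\in G}Z(\lambda\nu*_s\mu\nu)$, where $s(\lambda)=s(\mu)$, $G\subseteq s(\lambda)\Lambda$ is finite and not exhaustive, and $$Z(\lambda*_s\mu)=\{(x,d(\lambda)-d(\mu),y):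 x\in Z(\lambda),\ y\in Z(\mu),\ \sigma^{d(\lambda)}(x)=\sigma^{d(\mu)}(y)\}.$$ The stabilisation $S\Lambda$ is the $k$-graph obtained by attaching a copy of $\Omega_{k,\infty}$ to each vertex of $\Lambda$ as a head, in the following sense. Its vertices are the pairs $(v,n)$ with $v\in\Lambda^0$ and $n\in\mathbb N^k$, where $(v,0)$ is identified with $v$. Its morphisms are the triples $(n,m,\lambda)$ with $n,m\in\mathbb N^k$, $m\le n$, $\lambda\in\Lambda$ and $m\wedge d(\lambda)=0$, with range $(r(\lambda),n)$, source $(s(\lambda),m)$, degree $n-m+d(\lambda)$, composition $(n,m,\lambda)(m,l,\lambda')=(n,l,\lambda\lambda')$ and identities $(n,n,v)$. Thus $\lambda\in\Lambda$ is identified with $(0,0,\lambda)$, and for each $v\in\Lambda^0$ and $n\in\mathbb N^k$ there is a path $\mu_{n,v}=(n,0,v)$ of degree $n$ with range $(v,n)$ and source $v$. Let $\mathcal R=\mathbb N\times\mathbb N$ be the full countable equivalence relation, regarded as a discrete principal groupoid with unit space $\mathbb N$. Lemma. Let $\Lambda$ be a finitely aligned $k$-graph. Then $S\Lambda$ is finitely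 aligned, and $\mathcal G_{S\Lambda}\cong\mathcal G_\Lambda\times\mathcal R$ as topological groupoids; that is, there is an isomorphism of groupoids which is a homeomorphism, where $\mathcal G_\Lambda\times\mathcal R$ carries the product topology. -/

import Mathlib

universe u v

/-- A `k`-graph: a countable small category, presented by its objects, its morphisms ("paths"),
range, source, identities and composition (`comp μ ν` is the product `μν`, defined when
`s μ = r ν`), with a degree functor `d` to `ℕ^k` that has the factorisation property. -/
structure KGraph (k : ℕ) where
  Obj : Type u
  Path : Type u
  countable_obj : Countable Obj
  countable_path : Countable Path
  r : Path → Obj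
  s : Path → Obj
  one : Obj → Path
  comp : (μ ν : Path) → s μ = r ν → Path
  r_one : ∀ v, r (one v) = v
  s_one : ∀ v, s (one v) = v
  r_comp : ∀ μ ν h, r (comp μ ν h) = r μ
  s_comp : ∀ μ ν h, s (comp μ ν h) = s ν
  one_comp : ∀ v μ h, comp (one v) μ h = μ
  comp_one : ∀ μ v h, comp μ (one v) h = μ
  assoc : ∀ (l m n : Path) (h₁ : s l = r m) (h₂ : s m = r n),
    comp (comp l m h₁) n ((s_comp l m h₁).trans h₂) = comp l (comp m n h₂) (h₁.trans (r_comp m n h₂).symm)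
  d : Path → (Fin k → ℕ)
  d_one : ∀ v, d (one v) = 0
  d_comp : ∀ μ ν h, d (comp μ ν h) = d μ + d ν
  factorisation : ∀ (l : Path) (m n : Fin k → ℕ), d l = m + n →
    ∃! p : Path × Path, d p.1 = m ∧ d p.2 = n ∧ ∃ h : s p.1 = r p.2, comp p.1 p.2 h = l

namespace KGraph

variable {k : ℕ}

/-- `l` is an initial segment of `t`, i.e. `t(0, d l) = l`. -/
def IsInitial (Λ : KGraph.{u} k) (l t : Λ.Path) : Prop :=
  ∃ (ρ : Λ.Path) (h : Λ.s l = Λ.r ρ), Λ.comp l ρ h = t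

/-- The minimal common extensions of `l` and `m`. -/
def MCE (Λ : KGraph.{u} k) (l m : Λ.Path) : Set Λ.Path :=
  {t | Λ.d t = Λ.d l ⊔ Λ.d m ∧ Λ.IsInitial l t ∧ Λ.IsInitial m t}

/-- The set `Λ^min(l, m)`. -/
def minExt (Λ : KGraph.{u} k) (l m : Λ.Path) : Set (Λ.Path × Λ.Path) :=
  {p | ∃ (h₁ : Λ.s l = Λ.r p.1) (h₂ : Λ.s m = Λ.r p.2),
    Λ.comp l p.1 h₁ = Λ.comp m p.2 h₂ ∧ Λ.comp l p.1 h₁ ∈ Λ.MCE l m}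

def FinitelyAligned (Λ : KGraph.{u} k) : Prop :=
  ∀ l m : Λ.Path, (Λ.minExt l m).Finite

/-- `E` is an exhaustive subset of `vΛ`. -/
def Exhaustive (Λ : KGraph.{u} k) (v : Λ.Obj) (E : Set Λ.Path) : Prop :=
  (∀ m ∈ E, Λ.r m = v) ∧ ∀ l, Λ.r l = v → ∃ m ∈ E, (Λ.minExt l m).Nonempty

/-- `n ≤ m` for `n ∈ ℕ^k` and `m ∈ (ℕ ∪ {∞})^k`. -/
def LeDeg (n : Fin k → ℕ) (m : Fin k → ℕ∞) : Prop := ∀ i, (n i : ℕ∞) ≤ m i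

theorem LeDeg.mono {p q : Fin k → ℕ} {m : Fin k → ℕ∞} (h : p ≤ q) (hq : LeDeg q m) : LeDeg p m :=
  fun i => le_trans (by exact_mod_cast h i) (hq i)

theorem LeDeg.zero (m : Fin k → ℕ∞) : LeDeg 0 m := fun i => by simp

theorem LeDeg.add {m q : Fin k → ℕ} {e : Fin k → ℕ∞} (hm : LeDeg m e)
    (hq : LeDeg q (fun i => e i - m i)) : LeDeg (q + m) e := fun i => by
  have h := add_le_add_left (hq i) (m i : ℕ∞)
  rw [tsub_add_cancel_of_le (hm i)] at h
  simpa using h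

theorem LeDeg.sub {m q : Fin k → ℕ} {e : Fin k → ℕ∞}
    (h : LeDeg (q + m) e) : LeDeg q (fun i => e i - m i) := fun i => by
  have := h i
  simp only [Pi.add_apply, Nat.cast_add] at this
  exact ENat.le_sub_of_add_le_right (ENat.natCast_ne_top _) this

/-- A boundary path of `Λ`: a degree-preserving functor from the `k`-graph
`Ω_{k,deg} = {(p,q) : p ≤ q ≤ deg}` (objects `n ≤ deg`, range `p`, source `q`, degree `q - p`,
`(p,q)(q,t) = (p,t)`) to `Λ`, which meets every finite exhaustive set at each of its vertices. -/
structure BoundaryPath (Λ : KGraph.{u} k) where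
  deg : Fin k → ℕ∞
  obj : (n : Fin k → ℕ) → LeDeg n deg → Λ.Obj
  map : (p q : Fin k → ℕ) → p ≤ q → LeDeg q deg → Λ.Path
  r_map : ∀ p q hpq hq, Λ.r (map p q hpq hq) = obj p (hq.mono hpq)
  s_map : ∀ p q hpq hq, Λ.s (map p q hpq hq) = obj q hq
  map_one : ∀ n hn, map n n le_rfl hn = Λ.one (obj n hn)
  map_comp : ∀ p q t (hpq : p ≤ q) (hqt : q ≤ t) (ht : LeDeg t deg),
    Λ.comp (map p q hpq (ht.mono hqt)) (map q t hqt ht)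
      ((s_map p q hpq (ht.mono hqt)).trans (r_map q t hqt ht).symm) = map p t (hpq.trans hqt) ht
  d_map : ∀ p q hpq hq, Λ.d (map p q hpq hq) = q - p
  boundary : ∀ (n : Fin k → ℕ) (hn : LeDeg n deg) (E : Set Λ.Path), E.Finite →
    Λ.Exhaustive (obj n hn) E →
    ∃ l ∈ E, ∃ h : LeDeg (n + Λ.d l) deg, map n (n + Λ.d l) le_self_add h = l

namespace BoundaryPath

variable {Λ : KGraph.{u} k}

theorem ext' {x y : Λ.BoundaryPath} (hd : x.deg = y.deg)
    (hm : ∀ p q hpq hx hy, x.map p q hpq hx = y.map p q hpq hy) : x = y := by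
  have ho : ∀ n hx hy, x.obj n hx = y.obj n hy := fun n hx hy => by
    rw [← x.r_map n n le_rfl hx, hm n n le_rfl hx hy, y.r_map]
  cases x
  cases y
  subst hd
  congr
  · funext n hn; exact ho n hn hn
  · funext p q hpq hq; exact hm p q hpq hq hq

theorem map_congr (x : Λ.BoundaryPath) {p p' q q' : Fin k → ℕ} (hp : p = p') (hq : q = q')
    (h : p ≤ q) (h' : LeDeg q x.deg) :
    x.map p q h h' = x.map p' q' (hp ▸ hq ▸ h) (hq ▸ h') := by
  subst hp; subst hq; rfl

theorem map_congr_left {x y : Λ.BoundaryPath} (e : x = y) {p q : Fin k → ℕ}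
    (h : p ≤ q) (h' : LeDeg q x.deg) : x.map p q h h' = y.map p q h (e ▸ h') := by
  subst e; rfl

/-- The shift `σ^m(x)`, defined when `m ≤ d(x)`. -/
def shift (x : Λ.BoundaryPath) (m : Fin k → ℕ) (hm : LeDeg m x.deg) : Λ.BoundaryPath where
  deg := fun i => x.deg i - m i
  obj n hn := x.obj (n + m) (hm.add hn)
  map p q hpq hq := x.map (p + m) (q + m) (add_le_add_left hpq m) (hm.add hq)
  r_map _ _ _ _ := x.r_map _ _ _ _
  s_map _ _ _ _ := x.s_map _ _ _ _
  map_one _ _ := x.map_one _ _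
  map_comp _ _ _ hpq hqt ht := x.map_comp _ _ _ (add_le_add_left hpq m) (add_le_add_left hqt m) _
  d_map p q hpq hq := by rw [x.d_map]; funext i; exact Nat.add_sub_add_right _ _ _
  boundary n hn E hE hex := by
    obtain ⟨l, hl, h, e⟩ := x.boundary (n + m) (hm.add hn) E hE hex
    have e' : n + m + Λ.d l = n + Λ.d l + m := by abel
    have h' : LeDeg (n + Λ.d l + m) x.deg := e' ▸ h
    refine ⟨l, hl, h'.sub, ?_⟩
    rw [← x.map_congr rfl e' le_self_add h]
    exact e

theorem shift_shift (x : Λ.BoundaryPath) (m n : Fin k → ℕ) (hm : LeDeg m x.deg)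
    (hn : LeDeg n (x.shift m hm).deg) :
    (x.shift m hm).shift n hn = x.shift (n + m) (hm.add hn) := by
  refine ext' ?_ ?_
  · funext i
    simp only [shift, Pi.add_apply, Nat.cast_add]
    rw [tsub_tsub, add_comm]
  · intro p q hpq hx hy
    exact x.map_congr (add_assoc _ _ _) (add_assoc _ _ _) _ _

theorem shift_congr (x : Λ.BoundaryPath) {m n : Fin k → ℕ} (e : m = n) (hm : LeDeg m x.deg) :
    x.shift m hm = x.shift n (e ▸ hm) := by
  subst e; rfl

theorem shift_congr_left {x y : Λ.BoundaryPath} (e : x = y) {n : Fin k → ℕ} (hx : LeDeg n x.deg) :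
    x.shift n hx = y.shift n (e ▸ hx) := by
  subst e; rfl

end BoundaryPath

/-- The cylinder set `Z(l) = l ∂Λ`: the boundary paths `x` with `d(l) ≤ d(x)` and
`x(0, d(l)) = l`. -/
def Z (Λ : KGraph.{u} k) (l : Λ.Path) : Set Λ.BoundaryPath :=
  {x | ∃ h : LeDeg (Λ.d l) x.deg, x.map 0 (Λ.d l) (fun _ => Nat.zero_le _) h = l}

/-- `(x, m, y)` satisfies the condition defining the boundary path groupoid. -/
def TailEq (Λ : KGraph.{u} k) (x : Λ.BoundaryPath) (m : Fin k → ℤ) (y : Λ.BoundaryPath) : Prop :=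
  ∃ (p q : Fin k → ℕ) (hp : LeDeg p x.deg) (hq : LeDeg q y.deg),
    (∀ i, (p i : ℤ) - (q i : ℤ) = m i) ∧ x.shift p hp = y.shift q hq

/-- The set of triples `(x, m, y)` forming the boundary path groupoid. -/
def BPArrow (Λ : KGraph.{u} k) : Type u :=
  {t : Λ.BoundaryPath × (Fin k → ℤ) × Λ.BoundaryPath // Λ.TailEq t.1 t.2.1 t.2.2}

theorem TailEq.refl {Λ : KGraph.{u} k} (x : Λ.BoundaryPath) : Λ.TailEq x 0 x :=
  ⟨0, 0, LeDeg.zero _, LeDeg.zero _, by simp, rfl⟩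

theorem TailEq.symm {Λ : KGraph.{u} k} {x y : Λ.BoundaryPath} {m : Fin k → ℤ}
    (h : Λ.TailEq x m y) : Λ.TailEq y (-m) x := by
  obtain ⟨p, q, hp, hq, e, h⟩ := h
  exact ⟨q, p, hq, hp, fun i => by rw [Pi.neg_apply, ← e i]; ring, h.symm⟩

theorem TailEq.trans {Λ : KGraph.{u} k} {x y z : Λ.BoundaryPath} {m n : Fin k → ℤ}
    (h : Λ.TailEq x m y) (h' : Λ.TailEq y n z) : Λ.TailEq x (m + n) z := by
  obtain ⟨p, q, hp, hq, e, h⟩ := h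
  obtain ⟨p', q', hp', hq', e', h'⟩ := h'
  have hy : LeDeg (q ⊔ p') y.deg := fun i => by
    rcases le_total (q i) (p' i) with hh | hh
    · simpa [hh] using hp' i
    · simpa [hh] using hq i
  have e1 : (q ⊔ p' - q) + q = q ⊔ p' := tsub_add_cancel_of_le le_sup_left
  have e2 : (q ⊔ p' - p') + p' = q ⊔ p' := tsub_add_cancel_of_le le_sup_right
  have a1 : LeDeg (q ⊔ p' - q) (y.shift q hq).deg := LeDeg.sub (e1.symm ▸ hy)
  have a2 : LeDeg (q ⊔ p' - p') (y.shift p' hp').deg := LeDeg.sub (e2.symm ▸ hy)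
  have b1 : LeDeg (q ⊔ p' - q) (x.shift p hp).deg := h ▸ a1
  have b2 : LeDeg (q ⊔ p' - p') (z.shift q' hq').deg := h' ▸ a2
  refine ⟨_, _, hp.add b1, hq'.add b2, fun i => ?_, ?_⟩
  · have f1 := congrFun e1 i
    have f2 := congrFun e2 i
    have g1 := e i
    have g2 := e' i
    simp only [Pi.add_apply] at f1 f2 ⊢
    push_cast
    zify at f1 f2
    linarith
  · rw [← x.shift_shift _ _ hp b1, ← z.shift_shift _ _ hq' b2,
      BoundaryPath.shift_congr_left h b1, ← BoundaryPath.shift_congr_left h' a2,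
      y.shift_shift _ _ hq a1, y.shift_shift _ _ hp' a2]
    exact y.shift_congr (e1.trans e2.symm) _

end KGraph

/-- A groupoid, presented by objects and arrows (`mul a b` is the product `ab`, defined when
`s a = r b`), together with a topology on its set of arrows. -/
structure TopologizedGroupoid where
  Obj : Type u
  Arr : Type u
  top : TopologicalSpace Arr
  r : Arr → Obj
  s : Arr → Obj
  one : Obj → Arr
  inv : Arr → Arr
  mul : (a b : Arr) → s a = r b → Arr
  r_one : ∀ x, r (one x) = x
  s_one : ∀ x, s (one x) = x
  r_inv : ∀ a, r (inv a) = s a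
  s_inv : ∀ a, s (inv a) = r a
  r_mul : ∀ a b h, r (mul a b h) = r a
  s_mul : ∀ a b h, s (mul a b h) = s b
  one_mul : ∀ x a h, mul (one x) a h = a
  mul_one : ∀ a x h, mul a (one x) h = a
  mul_assoc : ∀ (a b c : Arr) (h₁ : s a = r b) (h₂ : s b = r c),
    mul (mul a b h₁) c ((s_mul a b h₁).trans h₂) = mul a (mul b c h₂) (h₁.trans (r_mul b c h₂).symm)
  inv_mul : ∀ a, mul (inv a) a (s_inv a) = one (s a)
  mul_inv : ∀ a, mul a (inv a) (r_inv a).symm = one (r a)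

attribute [instance] TopologizedGroupoid.top

namespace TopologizedGroupoid

/-- An isomorphism of topological groupoids: an invertible functor that is a homeomorphism between
the spaces of arrows. -/
structure Iso (G : TopologizedGroupoid.{u}) (H : TopologizedGroupoid.{v}) where
  obj : G.Obj ≃ H.Obj
  arr : G.Arr ≃ₜ H.Arr
  map_r : ∀ a, H.r (arr a) = obj (G.r a)
  map_s : ∀ a, H.s (arr a) = obj (G.s a)
  map_mul : ∀ (a b : G.Arr) (h : G.s a = G.r b),
    arr (G.mul a b h) = H.mul (arr a) (arr b) (by rw [map_s, map_r, h])

/-- The product groupoid, with the product topology. -/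
def prod (G : TopologizedGroupoid.{u}) (H : TopologizedGroupoid.{v}) :
    TopologizedGroupoid.{max u v} where
  Obj := G.Obj × H.Obj
  Arr := G.Arr × H.Arr
  top := inferInstance
  r a := (G.r a.1, H.r a.2)
  s a := (G.s a.1, H.s a.2)
  one x := (G.one x.1, H.one x.2)
  inv a := (G.inv a.1, H.inv a.2)
  mul a b h := (G.mul a.1 b.1 (congrArg Prod.fst h), H.mul a.2 b.2 (congrArg Prod.snd h))
  r_one _ := Prod.ext (G.r_one _) (H.r_one _)
  s_one _ := Prod.ext (G.s_one _) (H.s_one _)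
  r_inv _ := Prod.ext (G.r_inv _) (H.r_inv _)
  s_inv _ := Prod.ext (G.s_inv _) (H.s_inv _)
  r_mul _ _ _ := Prod.ext (G.r_mul _ _ _) (H.r_mul _ _ _)
  s_mul _ _ _ := Prod.ext (G.s_mul _ _ _) (H.s_mul _ _ _)
  one_mul _ _ _ := Prod.ext (G.one_mul _ _ _) (H.one_mul _ _ _)
  mul_one _ _ _ := Prod.ext (G.mul_one _ _ _) (H.mul_one _ _ _)
  mul_assoc _ _ _ _ _ := Prod.ext (G.mul_assoc _ _ _ _ _) (H.mul_assoc _ _ _ _ _)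
  inv_mul _ := Prod.ext (G.inv_mul _) (H.inv_mul _)
  mul_inv _ := Prod.ext (G.mul_inv _) (H.mul_inv _)

/-- The full countable equivalence relation `ℕ × ℕ`, as a discrete principal groupoid with unit
space `ℕ`: `r(p,q) = p`, `s(p,q) = q`, `(p,q)(q,t) = (p,t)`. -/
def fullCountable : TopologizedGroupoid.{0} where
  Obj := ℕ
  Arr := ℕ × ℕ
  top := ⊥
  r a := a.1
  s a := a.2
  one n := (n, n)
  inv a := (a.2, a.1)
  mul a b _ := (a.1, b.2)
  r_one _ := rfl
  s_one _ := rfl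
  r_inv _ := rfl
  s_inv _ := rfl
  r_mul _ _ _ := rfl
  s_mul _ _ _ := rfl
  one_mul _ _ h := Prod.ext h rfl
  mul_one _ _ h := Prod.ext rfl h.symm
  mul_assoc _ _ _ _ _ := rfl
  inv_mul _ := rfl
  mul_inv _ := rfl

end TopologizedGroupoid

namespace KGraph

variable {k : ℕ}

/-- The set `Z(l *_s m)` of arrows `(x, d(l) - d(m), y)` with `x ∈ Z(l)`, `y ∈ Z(m)` and
`σ^{d(l)}(x) = σ^{d(m)}(y)`. -/
def ZZ (Λ : KGraph.{u} k) (l m : Λ.Path) : Set Λ.BPArrow :=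
  {t | t.1.1 ∈ Λ.Z l ∧ t.1.2.2 ∈ Λ.Z m ∧ (∀ i, t.1.2.1 i = (Λ.d l i : ℤ) - (Λ.d m i : ℤ)) ∧
    ∃ (hl : LeDeg (Λ.d l) t.1.1.deg) (hm : LeDeg (Λ.d m) t.1.2.2.deg),
      t.1.1.shift (Λ.d l) hl = t.1.2.2.shift (Λ.d m) hm}

/-- The set `Z(l *_s m \ G)`: remove `Z(lν *_s mν)` for all `ν ∈ G`. -/
def ZZdiff (Λ : KGraph.{u} k) (l m : Λ.Path) (G : Set Λ.Path) : Set Λ.BPArrow :=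
  Λ.ZZ l m \ {t | ∃ ν ∈ G, ∃ (h₁ : Λ.s l = Λ.r ν) (h₂ : Λ.s m = Λ.r ν),
    t ∈ Λ.ZZ (Λ.comp l ν h₁) (Λ.comp m ν h₂)}

/-- The topology of the boundary path groupoid, generated by the sets `Z(l *_s m \ G)` with
`s(l) = s(m)` and `G` a finite nonexhaustive subset of `s(l)Λ`. -/
instance bpTopology (Λ : KGraph.{u} k) : TopologicalSpace Λ.BPArrow :=
  TopologicalSpace.generateFrom
    {U | ∃ (l m : Λ.Path) (G : Set Λ.Path), Λ.s l = Λ.s m ∧ G.Finite ∧ (∀ ν ∈ G, Λ.r ν = Λ.s l) ∧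
      ¬ Λ.Exhaustive (Λ.s l) G ∧ U = Λ.ZZdiff l m G}

/-- The boundary path groupoid of `Λ`. -/
def boundaryPathGroupoid (Λ : KGraph.{u} k) : TopologizedGroupoid.{u} where
  Obj := Λ.BoundaryPath
  Arr := Λ.BPArrow
  top := Λ.bpTopology
  r t := t.1.1
  s t := t.1.2.2
  one x := ⟨(x, 0, x), TailEq.refl x⟩
  inv t := ⟨(t.1.2.2, -t.1.2.1, t.1.1), t.2.symm⟩
  mul a b h := ⟨(a.1.1, a.1.2.1 + b.1.2.1, b.1.2.2), by
    have h1 := a.2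
    rw [h] at h1
    exact h1.trans b.2⟩
  r_one _ := rfl
  s_one _ := rfl
  r_inv _ := rfl
  s_inv _ := rfl
  r_mul _ _ _ := rfl
  s_mul _ _ _ := rfl
  one_mul x a h := Subtype.ext (Prod.ext h (Prod.ext (zero_add _) rfl))
  mul_one a x h := Subtype.ext (Prod.ext rfl (Prod.ext (add_zero _) h.symm))
  mul_assoc a b c h₁ h₂ := Subtype.ext (Prod.ext rfl (Prod.ext (add_assoc _ _ _) rfl))
  inv_mul a := Subtype.ext (Prod.ext rfl (Prod.ext (neg_add_cancel _) rfl))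
  mul_inv a := Subtype.ext (Prod.ext rfl (Prod.ext (add_neg_cancel _) rfl))

/-- The paths of the stabilisation. The path `(n, m, λ)` has range `(r(λ), n)`, source `(s(λ), m)`
and degree `n - m + d(λ)`; it runs down the head attached at `r(λ)` from level `n` to level `m` and
along `λ`, and a positive level `m i` may remain only in coordinates in which `λ` has no length. -/
@[ext]
structure StabPath (Λ : KGraph.{u} k) where
  top : Fin k → ℕ
  bot : Fin k → ℕ
  path : Λ.Path
  le : bot ≤ top
  disj : ∀ i, bot i = 0 ∨ Λ.d path i = 0

theorem factor_unique (Λ : KGraph.{u} k) {a b a' b' : Λ.Path} (h : Λ.s a = Λ.r b)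
    (h' : Λ.s a' = Λ.r b') (e : Λ.comp a b h = Λ.comp a' b' h') (ha : Λ.d a = Λ.d a') :
    a = a' ∧ b = b' := by
  have hb : Λ.d b = Λ.d b' := by
    have := congrArg Λ.d e
    rw [Λ.d_comp, Λ.d_comp, ha] at this
    exact add_left_cancel this
  obtain ⟨_, _, hu⟩ := Λ.factorisation (Λ.comp a b h) (Λ.d a) (Λ.d b) (Λ.d_comp _ _ _)
  have h1 := hu (a, b) ⟨rfl, rfl, h, rfl⟩
  have h2 := hu (a', b') ⟨ha.symm, hb.symm, h', e.symm⟩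
  have := h1.trans h2.symm
  exact ⟨congrArg Prod.fst this, congrArg Prod.snd this⟩

/-- The stabilisation `SΛ`. To every vertex `v` of `Λ` a copy of `Ω_{k,∞}` is attached as a head:
its vertices are `(v, n)` for `n ∈ ℕ^k`, with `(v, 0)` identified with `v`, and for `m ≤ n` there is
one path of degree `n - m` in it with range `(v, n)` and source `(v, m)`, namely `(n, m, v)`. The
remaining paths are those that the factorisation property forces: a path `(n, 0, λ)` is the product
of the path from `(r(λ), n)` to `r(λ)` with `λ`, and every path is an initial segment of one of
these. -/
def stabilisation (Λ : KGraph.{u} k) : KGraph.{u} k where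
  Obj := Λ.Obj × (Fin k → ℕ)
  Path := Λ.StabPath
  countable_obj := by
    have := Λ.countable_obj
    infer_instance
  countable_path := by
    have := Λ.countable_path
    refine Function.Injective.countable
      (f := fun x : Λ.StabPath => (x.top, x.bot, x.path)) ?_
    intro x y h
    simp only [Prod.mk.injEq] at h
    exact StabPath.ext h.1 h.2.1 h.2.2
  r x := (Λ.r x.path, x.top)
  s x := (Λ.s x.path, x.bot)
  one v := ⟨v.2, v.2, Λ.one v.1, le_rfl, fun i => Or.inr (by simp [Λ.d_one])⟩
  comp x y h := ⟨x.top, y.bot, Λ.comp x.path y.path (congrArg Prod.fst h),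
    y.le.trans ((congrArg Prod.snd h).symm.trans_le x.le), fun i => by
      have h2 := congrFun (congrArg Prod.snd h) i
      have h3 := y.le i
      have h4 := x.disj i
      have h5 := y.disj i
      simp only [Λ.d_comp, Pi.add_apply] at *
      omega⟩
  r_one v := Prod.ext (Λ.r_one _) rfl
  s_one v := Prod.ext (Λ.s_one _) rfl
  r_comp _ _ _ := Prod.ext (Λ.r_comp _ _ _) rfl
  s_comp _ _ _ := Prod.ext (Λ.s_comp _ _ _) rfl
  one_comp _ _ h := StabPath.ext (congrArg Prod.snd h) rfl (Λ.one_comp _ _ _)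
  comp_one _ _ h := StabPath.ext rfl (congrArg Prod.snd h).symm (Λ.comp_one _ _ _)
  assoc _ _ _ _ _ := StabPath.ext rfl rfl (Λ.assoc _ _ _ _ _)
  d x := x.top - x.bot + Λ.d x.path
  d_one v := by simp [Λ.d_one]
  d_comp x y h := by
    funext i
    have h2 := congrFun (congrArg Prod.snd h) i
    have h3 := y.le i
    have h4 := x.le i
    simp only [Λ.d_comp, Pi.add_apply, Pi.sub_apply] at *
    omega
  factorisation x a b hab := by
    have hd : Λ.d x.path = (a - x.top) + (Λ.d x.path - (a - x.top)) := by
      funext i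
      have h1 := congrFun hab i
      have h2 := x.le i
      have h3 := x.disj i
      simp only [Pi.add_apply, Pi.sub_apply] at *
      omega
    obtain ⟨⟨p, q⟩, ⟨hp, hq, h, hc⟩, -⟩ := Λ.factorisation x.path _ _ hd
    dsimp only at hp hq h hc
    refine ⟨(⟨x.top, x.top - a, p, tsub_le_self, fun i => ?_⟩,
      ⟨x.top - a, x.bot, q, fun i => ?_, fun i => ?_⟩), ⟨?_, ?_, Prod.ext h rfl,
        StabPath.ext rfl rfl hc⟩, ?_⟩
    · have := congrFun hp i
      simp only [Pi.sub_apply] at *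
      omega
    · have h1 := congrFun hab i
      have h2 := x.le i
      have h3 := x.disj i
      simp only [Pi.add_apply, Pi.sub_apply] at *
      omega
    · have h1 := congrFun hq i
      have h3 := x.disj i
      simp only [Pi.sub_apply] at *
      omega
    · funext i
      have h1 := congrFun hp i
      have h2 := congrFun hab i
      have h3 := x.disj i
      have h4 := x.le i
      simp only [Pi.add_apply, Pi.sub_apply] at *
      omega
    · funext i
      have h1 := congrFun hq i
      have h2 := congrFun hab i
      have h3 := x.disj i
      have h4 := x.le i
      simp only [Pi.add_apply, Pi.sub_apply] at *
      omega
    · rintro ⟨y, z⟩ ⟨hy, hz, hyz, hc'⟩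
      dsimp only at hy hz hyz hc'
      subst hc'
      have ht : y.bot = y.top - a := by
        funext i
        have h1 := congrFun hy i
        have h2 := y.le i
        have h3 := y.disj i
        simp only [Pi.add_apply, Pi.sub_apply] at *
        omega
      have hdy : Λ.d y.path = Λ.d p := by
        rw [hp]
        funext i
        have h1 := congrFun hy i
        have h2 := y.le i
        have h3 := y.disj i
        simp only [Pi.add_apply, Pi.sub_apply] at *
        omega
      obtain ⟨e1, e2⟩ := Λ.factor_unique (congrArg Prod.fst hyz) h hc.symm hdy
      exact Prod.ext (StabPath.ext rfl ht e1)
        (StabPath.ext ((congrArg Prod.snd hyz).symm.trans ht) rfl e2)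

end KGraph

namespace KGraph

variable {k : ℕ} {Λ : KGraph.{u} k}

/-! A path of the stabilisation is determined by its starting level, its degree and its underlying
path in `Λ`: with truncated subtraction, the final level is `top - d` and the underlying path has
degree `d - top` (`bot_eq`, `d_path`). So for paths starting at one level, having a common extension
is a question about the underlying paths (`minExt_stabilisation_nonempty_iff`), and so is
exhaustiveness (`exhaustive_stabilisation_iff`). Finite alignment passes up because a minimal
extension is recovered from its projection to `Λ`.

The path down the head from `(v, n)` to `v` is exhaustive on its own, so a boundary path must
descend its whole head (`level_le`). Hence boundary paths of the stabilisation are pairs of a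
boundary path of `Λ` and a level (`liftEquiv`). Shifting by `p` lowers level `n` to `n - p` and
shifts the rest by `p - n` (`lift_shift`), so tail equivalence is preserved once the lag is
corrected by the difference of the levels.

Arrows thus become an arrow of `Λ` with two levels, and each basic open set becomes a basic open set
of `Λ` times one point (`preimage_ZZdiff`). The levels form a countably infinite discrete set, which
gives the factor `ℕ × ℕ`. -/

theorem isInitial_comp (l ρ : Λ.Path) (h : Λ.s l = Λ.r ρ) : Λ.IsInitial l (Λ.comp l ρ h) :=
  ⟨ρ, h, rfl⟩

theorem mem_minExt_iff {l m ρ τ : Λ.Path} : (ρ, τ) ∈ Λ.minExt l m ↔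
    ∃ (h₁ : Λ.s l = Λ.r ρ) (h₂ : Λ.s m = Λ.r τ), Λ.comp l ρ h₁ = Λ.comp m τ h₂ ∧
      Λ.d (Λ.comp l ρ h₁) = Λ.d l ⊔ Λ.d m :=
  ⟨fun ⟨h₁, h₂, e, hm⟩ => ⟨h₁, h₂, e, hm.1⟩, fun ⟨h₁, h₂, e, hm⟩ =>
    ⟨h₁, h₂, e, hm, isInitial_comp _ _ _, e ▸ isInitial_comp _ _ _⟩⟩

/-- Multiplying `l` by the identity at its range or at its source gives two factorisations of `l`
whose first factors have degree zero, so these factors agree. -/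
theorem eq_one_of_d_eq_zero {l : Λ.Path} (h : Λ.d l = 0) : l = Λ.one (Λ.r l) :=
  ((Λ.factor_unique (Λ.s_one (Λ.r l)) (by rw [Λ.r_one] : Λ.s l = Λ.r (Λ.one (Λ.s l)))
    ((Λ.one_comp _ _ _).trans (Λ.comp_one _ _ _).symm) (by rw [Λ.d_one, h])).1).symm

theorem comp_eq_right {l m : Λ.Path} (h : Λ.s l = Λ.r m) (hl : Λ.d l = 0) : Λ.comp l m h = m := by
  have e := eq_one_of_d_eq_zero hl
  generalize Λ.r l = v at e
  subst e
  exact Λ.one_comp _ _ _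

theorem comp_eq_left {l m : Λ.Path} (h : Λ.s l = Λ.r m) (hm : Λ.d m = 0) : Λ.comp l m h = l := by
  have e := eq_one_of_d_eq_zero hm
  generalize Λ.r m = v at e
  subst e
  exact Λ.comp_one _ _ _

/-- Truncated subtraction covers positions inside a head of height `n` and positions below it at
once. -/
theorem LeDeg.add_natCast {p n : Fin k → ℕ} {e : Fin k → ℕ∞} :
    LeDeg p (fun i => e i + n i) ↔ LeDeg (p - n) e := by
  refine forall_congr' fun i => ?_
  rw [Pi.sub_apply, ENat.natCast_sub, tsub_le_iff_right]

/-! ### Paths of the stabilisation -/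

namespace StabPath

/-- By `disj`, a coordinate in which the path has length in `Λ` has reached level zero, where the
subtraction truncates. -/
theorem bot_eq (t : Λ.StabPath) : t.bot = t.top - Λ.stabilisation.d t := by
  funext i
  have h1 := t.le i
  have h2 := t.disj i
  simp only [stabilisation, Pi.add_apply, Pi.sub_apply] at *
  omega

theorem d_path (t : Λ.StabPath) : Λ.d t.path = Λ.stabilisation.d t - t.top := by
  funext i
  have h1 := t.le i
  have h2 := t.disj i
  simp only [stabilisation, Pi.add_apply, Pi.sub_apply] at *
  omega

theorem eq_of_d_eq {t t' : Λ.StabPath} (ht : t.top = t'.top) (hp : t.path = t'.path)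
    (hd : Λ.stabilisation.d t = Λ.stabilisation.d t') : t = t' :=
  StabPath.ext ht (by rw [bot_eq, bot_eq, ht, hd]) hp

end StabPath

open StabPath

/-! ### Minimal extensions and exhaustive sets -/

/-- A common extension forces equal starting levels, and truncated subtraction of that level
commutes with the join of degrees. -/
theorem path_mem_minExt {l m ρ τ : Λ.StabPath} (h : (ρ, τ) ∈ Λ.stabilisation.minExt l m) :
    (ρ.path, τ.path) ∈ Λ.minExt l.path m.path := by
  obtain ⟨h₁, h₂, e, hd⟩ := mem_minExt_iff.1 h
  refine mem_minExt_iff.2 ⟨congrArg Prod.fst h₁, congrArg Prod.fst h₂,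
    congrArg (StabPath.path (Λ := Λ)) e, ?_⟩
  have ht : l.top = m.top := (congrArg (StabPath.top (Λ := Λ)) e :)
  have h3 := d_path (Λ.stabilisation.comp l ρ h₁)
  rw [hd] at h3
  refine h3.trans ?_
  rw [d_path l, d_path m, ← ht]
  funext i
  simp only [Pi.sub_apply, Pi.sup_apply, stabilisation]
  omega

/-- Projection to `Λ` is injective on minimal extensions, since `l` and `m` already fix the starting
levels and degrees of both components. -/
theorem FinitelyAligned.stabilisation (hΛ : Λ.FinitelyAligned) : Λ.stabilisation.FinitelyAligned := by
  intro l m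
  refine Set.Finite.of_finite_image (f := fun p : Λ.StabPath × Λ.StabPath => (p.1.path, p.2.path))
    ((hΛ l.path m.path).subset ?_) ?_
  · rintro _ ⟨⟨ρ, τ⟩, h, rfl⟩
    exact path_mem_minExt h
  · rintro ⟨ρ, τ⟩ h ⟨ρ', τ'⟩ h' e
    obtain ⟨h₁, h₂, e₁, hd⟩ := mem_minExt_iff.1 h
    obtain ⟨h₁', h₂', e₁', hd'⟩ := mem_minExt_iff.1 h'
    simp only [Prod.mk.injEq] at e
    have hd2 : Λ.stabilisation.d (Λ.stabilisation.comp m τ h₂) =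
      Λ.stabilisation.d (Λ.stabilisation.comp m τ' h₂') := by rw [← e₁, ← e₁', hd, hd']
    rw [← hd', d_comp, d_comp] at hd
    rw [d_comp, d_comp] at hd2
    exact Prod.ext
      (eq_of_d_eq ((congrArg Prod.snd h₁).symm.trans (congrArg Prod.snd h₁')) e.1
        (add_left_cancel hd))
      (eq_of_d_eq ((congrArg Prod.snd h₂).symm.trans (congrArg Prod.snd h₂')) e.2
        (add_left_cancel hd2))

theorem minExt_stabilisation_nonempty_iff {l m : Λ.StabPath} (ht : l.top = m.top) :
    (Λ.stabilisation.minExt l m).Nonempty ↔ (Λ.minExt l.path m.path).Nonempty := by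
  refine ⟨fun ⟨p, h⟩ => ⟨_, path_mem_minExt h⟩, fun ⟨⟨ρ, τ⟩, h⟩ => ?_⟩
  obtain ⟨h₁, h₂, e, hd⟩ := mem_minExt_iff.1 h
  have hd' := hd
  rw [e] at hd'
  rw [d_comp] at hd hd'
  set D := Λ.stabilisation.d l ⊔ Λ.stabilisation.d m
  have key : ∀ i, D i = max (l.top i - l.bot i + Λ.d l.path i) (m.top i - m.bot i + Λ.d m.path i) :=
    fun i => rfl
  have f1 := l.disj
  have f2 := m.disj
  have f3 := l.le
  have f4 := m.le
  -- The levels are forced: the common extension has degree `D` and starts at `l.top`, so it ends at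
  -- `l.top - D`.
  let a : Λ.StabPath := ⟨l.bot, l.top - D, ρ, fun i => ?_, fun i => ?_⟩
  let b : Λ.StabPath := ⟨m.bot, l.top - D, τ, fun i => ?_, fun i => ?_⟩
  · refine ⟨(a, b), mem_minExt_iff.2 ⟨Prod.ext h₁ rfl, Prod.ext h₂ rfl, StabPath.ext ht rfl e, ?_⟩⟩
    refine (Λ.stabilisation.d_comp l a _).trans (?_ : _ = D)
    funext i
    have := key i
    have g1 := f1 i
    have g2 := f2 i
    have g3 := f3 i
    have g4 := f4 i
    have g5 := congrFun ht i
    have g6 := congrFun hd i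
    simp only [stabilisation, a, Pi.add_apply, Pi.sub_apply, Pi.sup_apply] at *
    omega
  all_goals
    have := key i
    have g1 := f1 i
    have g2 := f2 i
    have g3 := f3 i
    have g4 := f4 i
    have g5 := congrFun ht i
    have g6 := congrFun hd i
    have g7 := congrFun hd' i
    simp only [Pi.add_apply, Pi.sub_apply, Pi.sup_apply] at *
    omega

/-- The path `(n, 0, l)`. -/
def headPath (n : Fin k → ℕ) (l : Λ.Path) : Λ.StabPath := ⟨n, 0, l, zero_le, fun _ => Or.inl rfl⟩

theorem path_image_headPath (n : Fin k → ℕ) (G : Set Λ.Path) :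
    StabPath.path '' (headPath n '' G) = G := by
  rw [Set.image_image]
  exact Set.image_id G

theorem exhaustive_stabilisation_iff {v : Λ.Obj} {n : Fin k → ℕ} {E : Set Λ.StabPath}
    (hE : ∀ t ∈ E, t.top = n) :
    Λ.stabilisation.Exhaustive (v, n) E ↔ Λ.Exhaustive v (StabPath.path '' E) := by
  constructor
  · rintro ⟨h1, h2⟩
    refine ⟨?_, fun l hl => ?_⟩
    · rintro _ ⟨t, ht, rfl⟩
      exact congrArg Prod.fst (h1 t ht)
    · obtain ⟨t, ht, h⟩ := h2 (headPath n l) (Prod.ext hl rfl)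
      exact ⟨_, ⟨t, ht, rfl⟩, (minExt_stabilisation_nonempty_iff (hE t ht).symm).1 h⟩
  · rintro ⟨h1, h2⟩
    refine ⟨fun t ht => Prod.ext (h1 _ ⟨t, ht, rfl⟩) (hE t ht), fun l hl => ?_⟩
    obtain ⟨_, ⟨t, ht, rfl⟩, h⟩ := h2 l.path (congrArg Prod.fst hl)
    exact ⟨t, ht, (minExt_stabilisation_nonempty_iff
      ((congrArg Prod.snd hl).trans (hE t ht).symm)).2 h⟩

/-! ### Boundary paths of the stabilisation -/

namespace BoundaryPath

/-- The boundary path of the stabilisation that runs down the head of `x(0)` from level `n` and then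
along `x`. -/
def lift (x : Λ.BoundaryPath) (n : Fin k → ℕ) : Λ.stabilisation.BoundaryPath where
  deg i := x.deg i + n i
  obj p hp := (x.obj (p - n) (LeDeg.add_natCast.1 hp), n - p)
  map p q hpq hq :=
    ⟨n - p, n - q, x.map (p - n) (q - n) (tsub_le_tsub_right hpq n) (LeDeg.add_natCast.1 hq),
      tsub_le_tsub_left hpq n, fun i => by
        simp only [x.d_map, Pi.sub_apply]
        omega⟩
  r_map _ _ _ _ := Prod.ext (x.r_map _ _ _ _) rfl
  s_map _ _ _ _ := Prod.ext (x.s_map _ _ _ _) rfl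
  map_one _ _ := StabPath.ext rfl rfl (x.map_one _ _)
  map_comp _ _ _ _ _ _ := StabPath.ext rfl rfl (x.map_comp _ _ _ _ _ _)
  d_map p q hpq hq := by
    funext i
    have := hpq i
    simp only [stabilisation, x.d_map, Pi.sub_apply, Pi.add_apply]
    omega
  boundary p hp E hE hex := by
    have htop : ∀ t ∈ E, t.top = n - p := fun t ht => congrArg Prod.snd (hex.1 t ht)
    obtain ⟨_, ⟨t, ht, rfl⟩, h, e⟩ := x.boundary (p - n) (LeDeg.add_natCast.1 hp) _
      (hE.image StabPath.path) ((exhaustive_stabilisation_iff htop).1 hex)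
    have e1 : p + Λ.stabilisation.d t - n = p - n + Λ.d t.path := by
      funext i
      have h1 := t.le i
      have h2 := t.disj i
      have h3 := congrFun (htop t ht) i
      simp only [stabilisation, Pi.sub_apply, Pi.add_apply] at *
      omega
    refine ⟨t, ht, LeDeg.add_natCast.2 (e1 ▸ h), StabPath.ext (htop t ht).symm ?_ ?_⟩
    · exact (tsub_tsub n p _).symm.trans
        ((congrArg (· - _) (htop t ht).symm).trans t.bot_eq.symm)
    · exact (x.map_congr rfl e1 _ _).trans e

theorem leDeg_lift {x : Λ.BoundaryPath} {p n : Fin k → ℕ} :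
    LeDeg p (x.lift n).deg ↔ LeDeg (p - n) x.deg :=
  LeDeg.add_natCast

/-- In each coordinate the shift first uses up the head; only the excess `p - n` moves `x`. -/
theorem lift_shift (x : Λ.BoundaryPath) (n p : Fin k → ℕ) (hp : LeDeg p (x.lift n).deg) :
    (x.lift n).shift p hp = (x.shift (p - n) (leDeg_lift.1 hp)).lift (n - p) := by
  have e : ∀ q : Fin k → ℕ, q + p - n = q - (n - p) + (p - n) := fun q => by
    funext i
    simp only [Pi.sub_apply, Pi.add_apply]
    omega
  refine ext' ?_ fun a b hab hx hy => StabPath.ext ?_ ?_ (x.map_congr (e a) (e b) _ _)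
  · funext i
    have h1 := hp i
    simp only [shift, lift, Pi.sub_apply] at *
    generalize x.deg i = t at *
    cases t with
    | top =>
      rw [ENat.top_sub_natCast, top_add, top_add, ENat.top_sub_natCast]
    | coe t => norm_cast at *; omega
  · funext i
    simp only [shift, lift, Pi.sub_apply, Pi.add_apply]
    omega
  · funext i
    simp only [shift, lift, Pi.sub_apply, Pi.add_apply]
    omega

theorem level_eq (x : Λ.stabilisation.BoundaryPath) (p : Fin k → ℕ) (hp : LeDeg p x.deg) :
    (x.obj p hp).2 = (x.obj 0 (LeDeg.zero _)).2 - p := by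
  have h1 := x.r_map 0 p (fun _ => Nat.zero_le _) hp
  have h2 := x.s_map 0 p (fun _ => Nat.zero_le _) hp
  have h3 := x.d_map 0 p (fun _ => Nat.zero_le _) hp
  rw [← h1, ← h2]
  refine (bot_eq _).trans ?_
  rw [h3, tsub_zero]
  rfl

/-- The level in its head at which a boundary path of the stabilisation starts. -/
def level (x : Λ.stabilisation.BoundaryPath) : Fin k → ℕ := (x.obj 0 (LeDeg.zero _)).2

theorem top_map (x : Λ.stabilisation.BoundaryPath) (p q : Fin k → ℕ) (hpq : p ≤ q)
    (hq : LeDeg q x.deg) : (x.map p q hpq hq).top = x.level - p :=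
  (congrArg Prod.snd (x.r_map p q hpq hq)).trans (x.level_eq _ _)

/-- The path down the whole head projects to the identity at `v`, which exhausts all paths from `v`;
the boundary condition then makes `x` follow it. -/
theorem level_le (x : Λ.stabilisation.BoundaryPath) : LeDeg x.level x.deg := by
  obtain ⟨v, hv⟩ : ∃ v, x.obj 0 (LeDeg.zero _) = (v, x.level) := ⟨_, rfl⟩
  have hE : Λ.stabilisation.Exhaustive (x.obj 0 (LeDeg.zero _)) {headPath x.level (Λ.one v)} := by
    rw [hv]
    refine (exhaustive_stabilisation_iff fun t ht => congrArg StabPath.top ht).2 ?_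
    refine (Set.image_singleton (f := StabPath.path)).symm ▸ ?_
    refine ⟨by rintro _ rfl; exact Λ.r_one v, fun l hl => ⟨Λ.one v, rfl, (Λ.one (Λ.s l), l), ?_⟩⟩
    refine mem_minExt_iff.2 ⟨by rw [r_one], by rw [s_one, hl], ?_, ?_⟩
    · rw [comp_one, one_comp]
    · rw [comp_one, d_one]
      exact (sup_of_le_left (fun _ => Nat.zero_le _)).symm
  obtain ⟨l, rfl, h, -⟩ := x.boundary 0 (LeDeg.zero _) _ (Set.finite_singleton _) hE
  convert h using 1
  simp [stabilisation, headPath, d_one]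

/-- The part of a boundary path of the stabilisation below its head. -/
def tail (x : Λ.stabilisation.BoundaryPath) : Λ.BoundaryPath where
  deg i := x.deg i - x.level i
  obj p hp := (x.obj (p + x.level) (x.level_le.add hp)).1
  map p q hpq hq := (x.map (p + x.level) (q + x.level) (add_le_add_left hpq _)
    (x.level_le.add hq)).path
  r_map _ _ _ _ := congrArg Prod.fst (x.r_map _ _ _ _)
  s_map _ _ _ _ := congrArg Prod.fst (x.s_map _ _ _ _)
  map_one _ _ := congrArg StabPath.path (x.map_one _ _)
  map_comp _ _ _ hpq hqt ht := congrArg StabPath.path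
    (x.map_comp _ _ _ (add_le_add_left hpq _) (add_le_add_left hqt _) (x.level_le.add ht))
  d_map p q hpq hq := by
    refine (d_path _).trans ?_
    rw [x.d_map, top_map]
    funext i
    have := hpq i
    simp only [Pi.sub_apply, Pi.add_apply]
    omega
  boundary p hp E hE hex := by
    have hp' := x.level_le.add hp
    -- The head is used up here, so `E` can be regarded as a set of paths starting at level zero.
    have hlev : (x.obj _ hp').2 = 0 := (x.level_eq _ _).trans (tsub_eq_zero_of_le le_add_self)
    have hex' : Λ.stabilisation.Exhaustive (x.obj _ hp') (headPath 0 '' E) := by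
      have hv : x.obj _ hp' = ((x.obj _ hp').1, 0) := Prod.ext rfl hlev
      rw [hv]
      refine (exhaustive_stabilisation_iff ?_).2 ((path_image_headPath 0 E).symm ▸ hex)
      rintro _ ⟨l, -, rfl⟩
      rfl
    obtain ⟨_, ⟨l, hl, rfl⟩, h, e⟩ := x.boundary _ hp' _ (hE.image _) hex'
    have e1 : p + x.level + Λ.stabilisation.d (headPath 0 l) = p + Λ.d l + x.level := by
      simp only [stabilisation, headPath, tsub_zero, zero_add]
      abel
    refine ⟨l, hl, LeDeg.sub (e1 ▸ h), ?_⟩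
    rw [← x.map_congr rfl e1 le_self_add h, e]
    rfl

/-- Here `p - x.level + x.level` is the join of `p` and the level, so this segment only descends the
head. -/
theorem d_path_map_eq_zero (x : Λ.stabilisation.BoundaryPath) (p : Fin k → ℕ)
    (hp : LeDeg (p - x.level + x.level) x.deg) :
    Λ.d (x.map p (p - x.level + x.level) le_tsub_add hp).path = 0 := by
  refine (d_path _).trans ?_
  rw [x.d_map, top_map]
  funext i
  simp only [Pi.sub_apply, Pi.add_apply, Pi.zero_apply]
  omega

theorem lift_tail (x : Λ.stabilisation.BoundaryPath) : x.tail.lift x.level = x := by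
  refine ext' ?_ fun p q hpq hx hy => ?_
  · funext i
    exact tsub_add_cancel_of_le (x.level_le i)
  · have hq : LeDeg (q - x.level + x.level) x.deg := x.level_le.add (leDeg_lift.1 hx)
    have hpq' : p - x.level + x.level ≤ q - x.level + x.level :=
      add_le_add_left (tsub_le_tsub_right hpq _) _
    refine eq_of_d_eq (x.top_map p q hpq hy).symm ?_ (by rw [d_map, d_map])
    -- The segment from `p` to the join of `q` and the level is factored through `q`, and through
    -- the join of `p` and the level; in `Λ` the last factor of the one and the first factor of the
    -- other are identities.
    have e1 := congrArg StabPath.path (x.map_comp p q _ hpq le_tsub_add hq)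
    have e2 := congrArg StabPath.path (x.map_comp p _ _ le_tsub_add hpq' hq)
    have e3 := comp_eq_left (congrArg Prod.fst ((x.s_map p q hpq hy).trans
      (x.r_map q _ le_tsub_add hq).symm)) (x.d_path_map_eq_zero q hq)
    have e4 := comp_eq_right (congrArg Prod.fst ((x.s_map p _ le_tsub_add (hq.mono hpq')).trans
      (x.r_map _ _ hpq' hq).symm)) (x.d_path_map_eq_zero p (hq.mono hpq'))
    exact e4.symm.trans (e2.trans (e1.symm.trans e3))

theorem level_lift (x : Λ.BoundaryPath) (n : Fin k → ℕ) : (x.lift n).level = n := tsub_zero n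

theorem tail_lift (x : Λ.BoundaryPath) (n : Fin k → ℕ) : (x.lift n).tail = x := by
  have e : ∀ p : Fin k → ℕ, p + (x.lift n).level - n = p := fun p => by
    rw [level_lift, add_tsub_cancel_right]
  refine ext' ?_ fun p q hpq hx hy => x.map_congr (e p) (e q) _ _
  funext i
  change x.deg i + n i - ((x.lift n).level i : ℕ) = x.deg i
  rw [level_lift]
  exact (ENat.addLECancellable_natCast _).add_tsub_cancel_right

/-- The boundary paths of the stabilisation are the boundary paths of `Λ`, preceded by a part of a
head. -/
def liftEquiv (Λ : KGraph.{u} k) : Λ.BoundaryPath × (Fin k → ℕ) ≃ Λ.stabilisation.BoundaryPath where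
  toFun x := x.1.lift x.2
  invFun x := (x.tail, x.level)
  left_inv x := Prod.ext (tail_lift x.1 x.2) (level_lift x.1 x.2)
  right_inv x := lift_tail x

theorem lift_inj {x y : Λ.BoundaryPath} {a b : Fin k → ℕ} :
    x.lift a = y.lift b ↔ x = y ∧ a = b :=
  ((liftEquiv Λ).apply_eq_iff_eq (x := (x, a)) (y := (y, b))).trans Prod.mk_inj

theorem lift_mem_Z {x : Λ.BoundaryPath} {n : Fin k → ℕ} {l : Λ.StabPath} :
    x.lift n ∈ Λ.stabilisation.Z l ↔ n = l.top ∧ x ∈ Λ.Z l.path := by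
  have h0 : (0 : Fin k → ℕ) - n = 0 := zero_tsub n
  constructor
  · rintro ⟨h, e⟩
    have hn : n = l.top := by simpa [lift] using congrArg (fun t : Λ.StabPath => t.top) e
    subst hn
    refine ⟨rfl, ?_⟩
    have h' := leDeg_lift.1 h
    rw [← d_path] at h'
    exact ⟨h', (x.map_congr h0.symm l.d_path _ _).trans (congrArg StabPath.path e)⟩
  · rintro ⟨rfl, h, e⟩
    have hl : LeDeg (Λ.stabilisation.d l) (x.lift l.top).deg := by
      refine leDeg_lift.2 ?_
      rwa [← d_path]
    refine ⟨hl, eq_of_d_eq ?_ ?_ ?_⟩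
    · exact tsub_zero _
    · exact (x.map_congr h0 l.d_path.symm _ _).trans e
    · rw [d_map, tsub_zero]

end BoundaryPath

open BoundaryPath

/-! ### The groupoid of the stabilisation -/

theorem tailEq_lift_iff {x y : Λ.BoundaryPath} {a b : Fin k → ℕ} {m : Fin k → ℤ} :
    Λ.stabilisation.TailEq (x.lift a) (fun i => m i + a i - b i) (y.lift b) ↔ Λ.TailEq x m y := by
  constructor
  · rintro ⟨p, q, hp, hq, e, h⟩
    rw [lift_shift, lift_shift, lift_inj] at h
    refine ⟨p - a, q - b, leDeg_lift.1 hp, leDeg_lift.1 hq, fun i => ?_, h.1⟩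
    -- Equality of the remaining levels, `a - p = b - q`, accounts for the truncation in `p - a` and
    -- `q - b`.
    have h1 := congrFun h.2 i
    have h2 := e i
    simp only [Pi.sub_apply] at *
    omega
  · rintro ⟨p, q, hp, hq, e, h⟩
    refine ⟨p + a, q + b, leDeg_lift.2 (by simpa using hp),
      leDeg_lift.2 (by simpa using hq), fun i => ?_, ?_⟩
    · simp only [← e i, Pi.add_apply]
      push_cast
      ring
    · rw [lift_shift, lift_shift, lift_inj]
      refine ⟨?_, by rw [tsub_eq_zero_of_le le_add_self, tsub_eq_zero_of_le le_add_self]⟩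
      rw [x.shift_congr (add_tsub_cancel_right p a), y.shift_congr (add_tsub_cancel_right q b), h]

/-- The arrows of the groupoid of the stabilisation. -/
def arrEquiv (Λ : KGraph.{u} k) :
    Λ.BPArrow × ((Fin k → ℕ) × (Fin k → ℕ)) ≃ Λ.stabilisation.BPArrow where
  toFun t := ⟨(t.1.1.1.lift t.2.1, fun i => t.1.1.2.1 i + t.2.1 i - t.2.2 i,
    t.1.1.2.2.lift t.2.2), tailEq_lift_iff.2 t.1.2⟩
  invFun t := (⟨(t.1.1.tail, fun i => t.1.2.1 i - t.1.1.level i + t.1.2.2.level i, t.1.2.2.tail), by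
    refine (tailEq_lift_iff (a := t.1.1.level) (b := t.1.2.2.level)).1 ?_
    rw [lift_tail, lift_tail]
    convert t.2 using 2
    ring⟩, (t.1.1.level, t.1.2.2.level))
  left_inv t := Prod.ext (Subtype.ext (Prod.ext (tail_lift _ _) (Prod.ext (by
      simp only [level_lift]
      funext i
      ring) (tail_lift _ _)))) (Prod.ext (level_lift t.1.1.1 t.2.1) (level_lift t.1.1.2.2 t.2.2))
  right_inv t := Subtype.ext (Prod.ext (lift_tail _) (Prod.ext (by
      funext i
      dsimp only
      ring) (lift_tail _)))

theorem lift_shift_eq_iff {x y : Λ.BoundaryPath} {l m : Λ.StabPath} (h : l.bot = m.bot)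
    (hx : LeDeg (Λ.stabilisation.d l) (x.lift l.top).deg)
    (hy : LeDeg (Λ.stabilisation.d m) (y.lift m.top).deg)
    (hx' : LeDeg (Λ.d l.path) x.deg) (hy' : LeDeg (Λ.d m.path) y.deg) :
    (x.lift l.top).shift (Λ.stabilisation.d l) hx = (y.lift m.top).shift (Λ.stabilisation.d m) hy ↔
      x.shift (Λ.d l.path) hx' = y.shift (Λ.d m.path) hy' := by
  rw [lift_shift, lift_shift, lift_inj, ← bot_eq, ← bot_eq, x.shift_congr l.d_path,
    y.shift_congr m.d_path]
  exact and_iff_left h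

/-- The cylinders fix both starting levels. Since the final levels agree, they cancel in the lag and
in the comparison of shifts. -/
theorem arrEquiv_mem_ZZ {t : Λ.BPArrow × ((Fin k → ℕ) × (Fin k → ℕ))} {l m : Λ.StabPath}
    (h : l.bot = m.bot) : arrEquiv Λ t ∈ Λ.stabilisation.ZZ l m ↔
      t.1 ∈ Λ.ZZ l.path m.path ∧ t.2 = (l.top, m.top) := by
  obtain ⟨⟨⟨x, c, y⟩, ht⟩, a, b⟩ := t
  have hc : ∀ i, (c i + l.top i - m.top i = (Λ.stabilisation.d l i : ℤ) - Λ.stabilisation.d m i) ↔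
      c i = (Λ.d l.path i : ℤ) - Λ.d m.path i := fun i => by
    have h1 := congrFun h i
    have h2 := l.le i
    have h3 := m.le i
    simp only [stabilisation, Pi.add_apply, Pi.sub_apply] at *
    omega
  constructor
  · rintro ⟨hx, hy, hd, hl, hm, hs⟩
    obtain ⟨rfl, hx⟩ := lift_mem_Z.1 hx
    obtain ⟨rfl, hy⟩ := lift_mem_Z.1 hy
    refine ⟨⟨hx, hy, fun i => (hc i).1 (hd i), hx.1, hy.1, ?_⟩, rfl⟩
    exact (lift_shift_eq_iff h _ _ _ _).1 hs
  · rintro ⟨⟨hx, hy, hd, hl, hm, hs⟩, e⟩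
    obtain ⟨rfl, rfl⟩ := Prod.mk_inj.1 e
    have hx' := lift_mem_Z.2 ⟨rfl, hx⟩
    have hy' := lift_mem_Z.2 ⟨rfl, hy⟩
    refine ⟨hx', hy', fun i => (hc i).2 (hd i), hx'.1, hy'.1, ?_⟩
    exact (lift_shift_eq_iff h _ _ _ _).2 hs

theorem preimage_ZZdiff {l m : Λ.StabPath} {G : Set Λ.StabPath}
    (h : Λ.stabilisation.s l = Λ.stabilisation.s m)
    (hG : ∀ ν ∈ G, Λ.stabilisation.r ν = Λ.stabilisation.s l) :
    arrEquiv Λ ⁻¹' Λ.stabilisation.ZZdiff l m G =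
      Λ.ZZdiff l.path m.path (StabPath.path '' G) ×ˢ {(l.top, m.top)} := by
  have hb : l.bot = m.bot := congrArg Prod.snd h
  ext t
  simp only [ZZdiff, Set.mem_preimage, Set.mem_sdiff, arrEquiv_mem_ZZ hb, Set.mem_prod,
    Set.mem_singleton_iff, Set.mem_ofPred_eq, not_exists, not_and]
  constructor
  · rintro ⟨⟨h1, h2⟩, h3⟩
    refine ⟨⟨h1, ?_⟩, h2⟩
    rintro _ ⟨ν, hν, rfl⟩ _ _ h4
    -- Extending by `ν` keeps the starting levels, so the removed sets lie over the same point.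
    exact h3 ν hν (hG ν hν).symm (h.symm.trans (hG ν hν).symm)
      ((arrEquiv_mem_ZZ (l := Λ.stabilisation.comp l ν _)
        (m := Λ.stabilisation.comp m ν _) rfl).2 ⟨h4, h2⟩)
  · rintro ⟨⟨h1, h3⟩, h2⟩
    refine ⟨⟨h1, h2⟩, fun ν hν h4 h5 h6 => ?_⟩
    exact h3 _ ⟨ν, hν, rfl⟩ (congrArg Prod.fst h4) (congrArg Prod.fst h5)
      ((arrEquiv_mem_ZZ (l := Λ.stabilisation.comp l ν _)
        (m := Λ.stabilisation.comp m ν _) rfl).1 h6).1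

/-! ### Comparison of the topologies -/

theorem isOpen_ZZdiff {l m : Λ.Path} {G : Set Λ.Path} (h : Λ.s l = Λ.s m) (hf : G.Finite)
    (hG : ∀ ν ∈ G, Λ.r ν = Λ.s l) (hex : ¬ Λ.Exhaustive (Λ.s l) G) : IsOpen (Λ.ZZdiff l m G) :=
  TopologicalSpace.isOpen_generateFrom_of_mem ⟨l, m, G, h, hf, hG, hex, rfl⟩

/-- This allows `G = ∅`, so that the sets `ZZ l m` with `s l = s m` are themselves open. -/
theorem not_exhaustive_empty (v : Λ.Obj) : ¬ Λ.Exhaustive v ∅ := fun h => by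
  obtain ⟨_, hm, -⟩ := h.2 (Λ.one v) (Λ.r_one v)
  exact hm

theorem exists_mem_ZZ (t : Λ.BPArrow) : ∃ l m, Λ.s l = Λ.s m ∧ t ∈ Λ.ZZ l m := by
  obtain ⟨⟨x, c, y⟩, p, q, hp, hq, e, h⟩ := t
  have dl : Λ.d (x.map 0 p (fun _ => Nat.zero_le _) hp) = p := by rw [x.d_map, tsub_zero]
  have dm : Λ.d (y.map 0 q (fun _ => Nat.zero_le _) hq) = q := by rw [y.d_map, tsub_zero]
  refine ⟨x.map 0 p (fun _ => Nat.zero_le _) hp, y.map 0 q (fun _ => Nat.zero_le _) hq, ?_,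
    ⟨by rwa [dl], x.map_congr rfl dl _ _⟩, ⟨by rwa [dm], y.map_congr rfl dm _ _⟩,
    fun i => by rw [dl, dm]; exact (e i).symm, by rwa [dl], by rwa [dm],
    (x.shift_congr dl _).trans (h.trans (y.shift_congr dm _).symm)⟩
  have h0 : ∀ (z : Λ.BoundaryPath) n (hn : LeDeg n z.deg), z.obj n hn =
      Λ.r ((z.shift n hn).map 0 0 le_rfl (LeDeg.zero _)) := fun z n hn => by
    rw [r_map]
    change _ = z.obj (0 + n) _
    congr
    rw [zero_add]
  rw [s_map, s_map, h0, h0, map_congr_left h]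

theorem continuous_arrEquiv : Continuous (arrEquiv Λ) := by
  refine continuous_generateFrom_iff.2 ?_
  rintro _ ⟨l, m, G, h, hf, hG, hex, rfl⟩
  rw [preimage_ZZdiff h hG]
  refine (isOpen_ZZdiff (congrArg Prod.fst h) (hf.image _) ?_ ?_).prod (isOpen_discrete _)
  · rintro _ ⟨ν, hν, rfl⟩
    exact congrArg Prod.fst (hG ν hν)
  · exact (exhaustive_stabilisation_iff fun ν hν => congrArg Prod.snd (hG ν hν)).not.1 hex

theorem isOpen_image_ZZdiff {l m : Λ.Path} {G : Set Λ.Path} (h : Λ.s l = Λ.s m) (hf : G.Finite)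
    (hG : ∀ ν ∈ G, Λ.r ν = Λ.s l) (hex : ¬ Λ.Exhaustive (Λ.s l) G) (a b : Fin k → ℕ) :
    IsOpen ((arrEquiv Λ).symm ⁻¹' (Λ.ZZdiff l m G ×ˢ {(a, b)})) := by
  -- Prefixing heads of heights `a` and `b` realises any pair of levels; both sources are at level
  -- zero, where `G` is placed.
  have hs : Λ.stabilisation.s (headPath a l) = Λ.stabilisation.s (headPath b m) := Prod.ext h rfl
  have hr : ∀ ν ∈ headPath 0 '' G, Λ.stabilisation.r ν = Λ.stabilisation.s (headPath a l) := by
    rintro _ ⟨ν, hν, rfl⟩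
    exact Prod.ext (hG ν hν) rfl
  have hp := preimage_ZZdiff hs hr
  rw [path_image_headPath] at hp
  refine (congrArg IsOpen ?_).mp (isOpen_ZZdiff hs (hf.image _) hr ?_)
  · exact ((arrEquiv Λ).symm.preimage_symm_preimage _).symm.trans
      (congrArg ((arrEquiv Λ).symm ⁻¹' ·) hp)
  · refine (exhaustive_stabilisation_iff ?_).not.2
      ((path_image_headPath 0 G).symm ▸ hex)
    rintro _ ⟨ν, -, rfl⟩
    rfl

theorem continuous_arrEquiv_symm : Continuous (arrEquiv Λ).symm := by
  have key : ∀ l m (G : Set Λ.Path) (V : Set ((Fin k → ℕ) × (Fin k → ℕ))), Λ.s l = Λ.s m →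
      G.Finite → (∀ ν ∈ G, Λ.r ν = Λ.s l) → ¬ Λ.Exhaustive (Λ.s l) G →
      IsOpen ((arrEquiv Λ).symm ⁻¹' (Λ.ZZdiff l m G ×ˢ V)) := by
    intro l m G V h hf hG hex
    have : Λ.ZZdiff l m G ×ˢ V = ⋃ v ∈ V, Λ.ZZdiff l m G ×ˢ {v} := by
      ext t
      simp
    rw [this, Set.preimage_iUnion₂]
    exact isOpen_biUnion fun v _ => isOpen_image_ZZdiff h hf hG hex v.1 v.2
  rw [show ⇑(arrEquiv Λ).symm =
    fun t => (((arrEquiv Λ).symm t).1, ((arrEquiv Λ).symm t).2) from rfl]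
  refine Continuous.prodMk (continuous_generateFrom_iff.2 ?_) (continuous_def.2 fun V _ => ?_)
  · rintro _ ⟨l, m, G, h, hf, hG, hex, rfl⟩
    have := key l m G Set.univ h hf hG hex
    rwa [Set.prod_univ] at this
  -- The generators with `G = ∅` cover all arrows of `Λ`, so a condition on levels alone is a union
  -- of sets treated in `key`.
  · have : (Prod.snd ⁻¹' V : Set (Λ.BPArrow × ((Fin k → ℕ) × (Fin k → ℕ)))) =
        ⋃ (l : Λ.Path) (m : Λ.Path) (_ : Λ.s l = Λ.s m), Λ.ZZdiff l m ∅ ×ˢ V := by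
      ext t
      obtain ⟨l, m, h, ht⟩ := exists_mem_ZZ t.1
      simp only [Set.mem_preimage, Set.mem_iUnion, Set.mem_prod, exists_prop]
      exact ⟨fun hV => ⟨l, m, h, ⟨ht, fun ⟨_, hν, _⟩ => hν⟩, hV⟩, fun ⟨_, _, _, _, hV⟩ => hV⟩
    change IsOpen ((arrEquiv Λ).symm ⁻¹' (Prod.snd ⁻¹' V))
    rw [this]
    simp only [Set.preimage_iUnion]
    exact isOpen_iUnion fun l => isOpen_iUnion fun m => isOpen_iUnion fun h =>
      key l m ∅ V h Set.finite_empty (fun _ => False.elim) (not_exhaustive_empty _)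

/-- `arrEquiv` as a homeomorphism. -/
def arrHomeomorph (Λ : KGraph.{u} k) :
    Λ.BPArrow × ((Fin k → ℕ) × (Fin k → ℕ)) ≃ₜ Λ.stabilisation.BPArrow where
  toEquiv := arrEquiv Λ
  continuous_toFun := continuous_arrEquiv
  continuous_invFun := continuous_arrEquiv_symm

/-- An enumeration of the levels, as a homeomorphism onto the arrows of the full countable
equivalence relation. -/
def levelHomeomorph (e : (Fin k → ℕ) ≃ ℕ) :
    (Fin k → ℕ) × (Fin k → ℕ) ≃ₜ TopologizedGroupoid.fullCountable.Arr where
  toEquiv := e.prodCongr e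
  continuous_toFun := continuous_of_discreteTopology
  continuous_invFun := continuous_bot

/-- The groupoid of the stabilisation is the product of the groupoid of `Λ` with the full countable
equivalence relation, by an enumeration of the levels of the heads. -/
def stabilisationIso (Λ : KGraph.{u} k) (e : (Fin k → ℕ) ≃ ℕ) :
    TopologizedGroupoid.Iso Λ.stabilisation.boundaryPathGroupoid
      (Λ.boundaryPathGroupoid.prod TopologizedGroupoid.fullCountable) where
  obj := (liftEquiv Λ).symm.trans ((Equiv.refl _).prodCongr e)
  arr := (arrHomeomorph Λ).symm.trans ((Homeomorph.refl _).prodCongr (levelHomeomorph e))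
  map_r _ := rfl
  map_s _ := rfl
  map_mul a b h := by
    refine Prod.ext (Subtype.ext (Prod.ext rfl (Prod.ext (funext fun i => ?_) rfl))) rfl
    have h' : a.1.2.2 = b.1.1 := h
    change a.1.2.1 i + b.1.2.1 i - a.1.1.level i + b.1.2.2.level i =
      a.1.2.1 i - a.1.1.level i + a.1.2.2.level i + (b.1.2.1 i - b.1.1.level i + b.1.2.2.level i)
    -- The level corrections at the common middle unit cancel.
    rw [h']
    ring

end KGraph

theorem lemma5p2 {k : ℕ} (hk : 0 < k) (Λ : KGraph.{u} k) (hΛ : Λ.FinitelyAligned) :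
    Λ.stabilisation.FinitelyAligned ∧
      Nonempty (TopologizedGroupoid.Iso Λ.stabilisation.boundaryPathGroupoid
        (Λ.boundaryPathGroupoid.prod TopologizedGroupoid.fullCountable)) := by
  -- With `k` positive the set of levels is infinite, as the enumeration by `ℕ` requires.
  have : Nonempty (Fin k) := ⟨⟨0, hk⟩⟩
  obtain ⟨e⟩ : Nonempty ((Fin k → ℕ) ≃ ℕ) := nonempty_equiv_of_countable
  exact ⟨hΛ.stabilisation, ⟨KGraph.stabilisationIso Λ e⟩⟩
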